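/- Let $G_{\mathbb C}$ be a connected complex reductive algebraic group (or, more generally, any connected complex Lie group) with Lie algebra $\mathfrak g_{\mathbb C}$, and let $\sigma,\tau$ be commuting antiholomorphic involutive automorphisms of $G_{\mathbb C}$ such that the fixed point group $U=G_{\mathbb C}^{\tau}$ is compact. Put $G=G_{\mathbb C}^{\sigma}$ (the real form defined by $\sigma$) and $\theta=\tau\sigma=\sigma\tau$ (the Cartan involution), and write $\sigma$ also for the induced conjugate-linear involution of $\mathfrak g_{\mathbb C}$. Let $(\pi,V)$ be a finite-dimensional holomorphic complex representation of $G_{\mathbb C}$, write $X.v$ for the differentiated action of $X\in\mathfrak g_{\mathbb C}$ on $v\in V$, and let $(\pi^\theta,V)$ be the representation $\pi^\theta(g)=\pi(\theta g)$, $g\in G_{\mathbb C}$. The following are equivalent. (a) $V$ admits a $G$-invariant nondegenerate hermitian form $\langle\cdot,\cdot\rangle$. Here $G$-invariance may be understood as $\langle\pi(g)v,\pi(g)w\rangle=\langle v,w\rangle$ for all $g\in G$, $v,w\in V$, or as $\langle X.v,w\rangle=\langle v,-\sigma(X).w\rangle$ for all $X\in\mathfrak g_{\mathbb C}$, $v,w\in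 V$, or as both conditions together. (b) $(\pi,V)$ and $(\pi^\theta,V)$ are isomorphic as representations of $G$; or, what is also equivalent, there is a complex-linear isomorphism $T:V\to V$ with $T\circ\pi(g)=\pi(\theta g)\circ T$ for all $g\in G_{\mathbb C}$. -/

import Mathlib

open scoped Manifold ContDiff

noncomputable section

section Definitions

variable {E : Type*} [NormedAddCommGroup E] [NormedSpace ℂ E]
  {G : Type*} [TopologicalSpace G] [ChartedSpace E G] [Group G]
  {V : Type*} [NormedAddCommGroup V] [NormedSpace ℂ V]

/-- The real differential of a self-map `f` of a complex manifold modelled on `E`, at the point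
`g`. The tangent spaces at `g` and at `f g` are both identified with the model space `E`. -/
def realDifferential (E : Type*) [NormedAddCommGroup E] [NormedSpace ℂ E]
    {G : Type*} [TopologicalSpace G] [ChartedSpace E G] (f : G → G) (g : G) : E →L[ℝ] E :=
  mfderiv 𝓘(ℝ, E) 𝓘(ℝ, E) f g

/-- An antiholomorphic involution of a complex Lie group `G` (modelled on `E`): an involutive
group automorphism which is smooth for the underlying real structure and whose differential is
conjugate-linear at every point. -/
structure IsAntiholomorphicInvolution (E : Type*) [NormedAddCommGroup E] [NormedSpace ℂ E]
    {G : Type*} [TopologicalSpace G] [ChartedSpace E G] [Group G] (σ : G →* G) : Prop where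
  involutive : Function.Involutive σ
  smooth : ContMDiff 𝓘(ℝ, E) 𝓘(ℝ, E) ∞ σ
  conj_linear : ∀ (g : G) (c : ℂ) (x : E),
    realDifferential E σ g (c • x) = (starRingEnd ℂ c) • realDifferential E σ g x

/-- The subgroup of fixed points of `σ`. -/
def fixedPointSubgroup (σ : G →* G) : Subgroup G :=
  σ.eqLocus (MonoidHom.id G)

/-- The map induced by an endomorphism `σ` of `G` on the Lie algebra of `G` (the tangent space
at `1`): the real differential of `σ` at `1`, where `σ 1 = 1`. -/
def lieInvolution (σ : G →* G) (X : GroupLieAlgebra 𝓘(ℂ, E) G) : GroupLieAlgebra 𝓘(ℂ, E) G :=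
  realDifferential E σ 1 X

/-- A representation on a finite-dimensional complex space `V` is holomorphic if all its orbit
maps are. (The norm of `V` only provides the canonical topology of `V`.) -/
def IsHolomorphicRep (E : Type*) [NormedAddCommGroup E] [NormedSpace ℂ E]
    {G : Type*} [TopologicalSpace G] [ChartedSpace E G] [Group G]
    {V : Type*} [NormedAddCommGroup V] [NormedSpace ℂ V] (π : Representation ℂ G V) : Prop :=
  ∀ v : V, ContMDiff 𝓘(ℂ, E) 𝓘(ℂ, V) ω (fun g : G => π g v)

/-- The action `X.v` of the Lie algebra of `G` on `V` obtained by differentiating `π`: the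
differential at `1` of the orbit map `g ↦ π g v`, in the direction `X`. -/
def lieAction (π : Representation ℂ G V) (X : GroupLieAlgebra 𝓘(ℂ, E) G) (v : V) : V :=
  (mfderiv 𝓘(ℂ, E) 𝓘(ℂ, V) (fun g : G => π g v) 1 : E →L[ℂ] V) X

/-- The twist `π^θ` of `π` by an endomorphism `θ` of the group: `π^θ(g) = π(θ g)`. -/
def twist (π : Representation ℂ G V) (θ : G →* G) : Representation ℂ G V :=
  MonoidHom.comp π θ

/-- The restriction of a representation to a subgroup. -/
def restrictRep (π : Representation ℂ G V) (H : Subgroup G) : Representation ℂ H V :=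
  MonoidHom.comp π H.subtype

/-- Nondegenerate hermitian forms (conjugate-linear in the first variable, linear in the
second). -/
def IsNondegHermitian (B : V →ₗ⋆[ℂ] V →ₗ[ℂ] ℂ) : Prop :=
  B.IsSymm ∧ B.Nondegenerate

/-- Invariance of a form under a subgroup `H`: `⟨π(g)v, π(g)w⟩ = ⟨v, w⟩` for `g` in `H`. -/
def IsGroupInvariant (π : Representation ℂ G V) (H : Subgroup G)
    (B : V →ₗ⋆[ℂ] V →ₗ[ℂ] ℂ) : Prop :=
  ∀ g ∈ H, ∀ v w : V, B (π g v) (π g w) = B v w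

/-- `σ`-invariance of a form: `⟨X.v, w⟩ = ⟨v, -σ(X).w⟩` for all `X` in the Lie algebra of the
complex group `G`. -/
def IsLieInvariant (E : Type*) [NormedAddCommGroup E] [NormedSpace ℂ E]
    {G : Type*} [TopologicalSpace G] [ChartedSpace E G] [Group G]
    {V : Type*} [NormedAddCommGroup V] [NormedSpace ℂ V]
    (π : Representation ℂ G V) (σ : G →* G) (B : V →ₗ⋆[ℂ] V →ₗ[ℂ] ℂ) : Prop :=
  ∀ (X : GroupLieAlgebra 𝓘(ℂ, E) G) (v w : V),
    B (lieAction π X v) w = B v (-lieAction π (lieInvolution σ X) w)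

end Definitions

end

/-!
The argument rests on one condition for a sesquilinear form `B` and an antiholomorphic
involution `ρ` of the complex group: the twisted invariance `B(π(g)v, π(ρ g)w) = B(v, w)` for all
`g` in the complex group. It is equivalent to invariance under the fixed points of `ρ` and to
invariance under the Lie algebra.

* Fixed points: `g ↦ B(π(ρ g)v, π(g)w)` is holomorphic, since two conjugations cancel. Averaging a
  chart with its `ρ`-transform makes `ρ` linear near `1`
  (`IsAntiholomorphicInvolution.exists_linearizing_chart`), so that its fixed points are locally the
  real points of a complex vector space, on which a holomorphic function is determined by its values
  (`eventually_eq_zero_of_eq_zero_on_fixed`). The identity then holds near `1`, hence on the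
  connected group, as it defines a subgroup (`twistedInvariant_of_isGroupInvariant`).
* Lie algebra: the real differential of `g ↦ B(π(g)v, π(ρ g)w)` at `1` is
  `X ↦ B(X.v, w) + B(v, ρ(X).w)`, and translations transport its vanishing to all points
  (`isLieInvariant_of_twistedInvariant`, `twistedInvariant_of_isLieInvariant`).

As the fixed points of `τ` form a compact group, averaging gives a nondegenerate form `h` invariant
under them, and thus with twisted invariance for `τ`. The relation `B(v, w) = h(v, T w)` then
matches the forms `B` with twisted invariance for `σ` with the operators `T` that intertwine `π` and
its twist by `τ ∘ σ`; nondegeneracy of `B` is invertibility of `T`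
(`exists_intertwiner_of_twistedInvariant`, `isGroupInvariant_of_intertwiner`). The form coming from
an intertwiner need not be hermitian, but a combination of it with its conjugate transpose is
hermitian and nondegenerate (`exists_isNondegHermitian_combination`).
-/

open scoped Manifold ContDiff
open Filter Topology

noncomputable section

/-! ### Linearization of antiholomorphic involutions -/

theorem differentiableAt_complex_of_real {E F : Type*} [NormedAddCommGroup E] [NormedSpace ℂ E]
    [NormedAddCommGroup F] [NormedSpace ℂ F] {f : E → F} {f' : E →L[ℝ] F} {x : E}
    (hf : HasFDerivAt f f' x) (hlin : ∀ (c : ℂ) (z : E), f' (c • z) = c • f' z) :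
    DifferentiableAt ℂ f x := by
  rw [differentiableAt_iff_restrictScalars ℝ hf.differentiableAt, hf.fderiv]
  exact ⟨{ toFun := f', map_add' := f'.map_add, map_smul' := hlin, cont := f'.cont }, rfl⟩

theorem map_complex_smul_of_inverse {E : Type*} [NormedAddCommGroup E] [NormedSpace ℂ E]
    {A A' : E →L[ℝ] E} (hA : ∀ (c : ℂ) (z : E), A (c • z) = c • A z)
    (hl : ∀ z, A' (A z) = z) (hr : ∀ z, A (A' z) = z) (c : ℂ) (z : E) :
    A' (c • z) = c • A' z := by
  rw [← hr z, ← hA, hl, hl]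

/-- An antiholomorphic involution `s` of a neighbourhood of a fixed point `x₀` in a complex Banach
space is, in a suitable holomorphic coordinate, its conjugate-linear differential `S`. The map `Θ`
is the inverse of this coordinate. -/
theorem exists_linearizing_inverse {E : Type*} [NormedAddCommGroup E] [NormedSpace ℂ E]
    [CompleteSpace E] {s : E → E} {x₀ : E} (hs₀ : s x₀ = x₀) (hs : ContDiffAt ℝ 1 s x₀)
    (hinv : ∀ᶠ x in 𝓝 x₀, s (s x) = x)
    (hconj : ∀ᶠ x in 𝓝 x₀, ∀ (c : ℂ) (z : E),
      fderiv ℝ s x (c • z) = starRingEnd ℂ c • fderiv ℝ s x z) :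
    ∃ (S : E →L[ℝ] E) (Θ : E → E), (∀ (c : ℂ) (z : E), S (c • z) = starRingEnd ℂ c • S z) ∧
      (∀ z, S (S z) = z) ∧ map Θ (𝓝 0) = 𝓝 x₀ ∧
      (∀ᶠ y in 𝓝 0, DifferentiableAt ℂ Θ y) ∧ ∀ᶠ y in 𝓝 0, s (Θ y) = Θ (S y) := by
  set S := fderiv ℝ s x₀ with hS
  have hsd : HasStrictFDerivAt s S x₀ := hs.hasStrictFDerivAt one_ne_zero
  have hSc : ∀ (c : ℂ) (z : E), S (c • z) = starRingEnd ℂ c • S z := hconj.self_of_nhds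
  have hSS : ∀ z, S (S z) = z := by
    have h1 : HasFDerivAt (s ∘ s) (S.comp S) x₀ :=
      HasFDerivAt.comp x₀ (by rw [hs₀]; exact hsd.hasFDerivAt) hsd.hasFDerivAt
    have h2 : HasFDerivAt (s ∘ s) (ContinuousLinearMap.id ℝ E) x₀ :=
      (hasFDerivAt_id x₀).congr_of_eventuallyEq hinv
    intro z
    exact DFunLike.congr_fun (h1.unique h2) z
  -- the average of the identity and of `S ∘ s` conjugates `s` to `S`
  let Ψ : E → E := fun x => (2⁻¹ : ℝ) • ((x - x₀) + S (s x - x₀))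
  have hΨ₀ : Ψ x₀ = 0 := by simp [Ψ, hs₀]
  have hΨd : ∀ x s', HasFDerivAt s s' x →
      HasFDerivAt Ψ ((2⁻¹ : ℝ) • (ContinuousLinearMap.id ℝ E + S.comp s')) x := fun x s' h =>
    (((hasFDerivAt_id x).sub_const x₀).add
      (S.hasFDerivAt.comp x (h.sub_const x₀))).const_smul (2⁻¹ : ℝ)
  have hΨs : HasStrictFDerivAt Ψ ((ContinuousLinearEquiv.refl ℝ E : E ≃L[ℝ] E) : E →L[ℝ] E) x₀ := by
    have h : HasStrictFDerivAt Ψ ((2⁻¹ : ℝ) • (ContinuousLinearMap.id ℝ E + S.comp S)) x₀ :=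
      (((hasStrictFDerivAt_id x₀).sub_const x₀).add
        (S.hasStrictFDerivAt.comp x₀ (hsd.sub_const x₀))).const_smul (2⁻¹ : ℝ)
    convert h using 1
    ext z
    simp only [ContinuousLinearEquiv.coe_coe, ContinuousLinearEquiv.refl_apply,
      smul_apply, add_apply, ContinuousLinearMap.id_apply,
      ContinuousLinearMap.comp_apply, hSS]
    rw [← two_smul ℝ z, smul_smul]
    norm_num
  have hΨC : ContDiffAt ℝ 1 Ψ x₀ :=
    ((contDiffAt_id.sub contDiffAt_const).add
      (S.contDiff.contDiffAt.comp x₀ (hs.sub contDiffAt_const))).const_smul (2⁻¹ : ℝ)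
  -- `Ψ` is inverted as a real map; its inverse is shown to be holomorphic below
  let Θ : E → E := hΨs.localInverse Ψ _ x₀
  have hleft : ∀ᶠ x in 𝓝 x₀, Θ (Ψ x) = x := hΨs.eventually_left_inverse
  have hright : ∀ᶠ y in 𝓝 0, Ψ (Θ y) = y := by rw [← hΨ₀]; exact hΨs.eventually_right_inverse
  have hmapΨ : map Ψ (𝓝 x₀) = 𝓝 0 := by
    rw [← hΨ₀]; exact hΨs.map_nhds_eq_of_equiv
  have hmap : map Θ (𝓝 0) = 𝓝 x₀ := by
    rw [← hmapΨ, map_map]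
    exact (map_congr hleft).trans map_id
  have hΘC : ContDiffAt ℝ 1 Θ 0 := by
    have := hΨC.to_localInverse (f' := ContinuousLinearEquiv.refl ℝ E) hΨs.hasFDerivAt one_ne_zero
    rw [hΨ₀] at this
    exact this
  have hΘt : Tendsto Θ (𝓝 0) (𝓝 x₀) := hmap.le
  have hΨlin : ∀ᶠ x in 𝓝 x₀, ∃ A : E →L[ℝ] E, HasFDerivAt Ψ A x ∧
      ∀ (c : ℂ) (z : E), A (c • z) = c • A z := by
    filter_upwards [hs.eventually (by simp), hconj] with x hx hc
    refine ⟨_, hΨd x _ (hx.differentiableAt one_ne_zero).hasFDerivAt, fun c z => ?_⟩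
    simp only [smul_apply, add_apply,
      ContinuousLinearMap.id_apply, ContinuousLinearMap.comp_apply, hc, hSc, Complex.conj_conj]
    rw [← smul_add, smul_comm]
  have hst : Tendsto s (𝓝 x₀) (𝓝 x₀) := by
    have := hs.continuousAt.tendsto
    rwa [hs₀] at this
  refine ⟨S, Θ, hSc, hSS, hmap, ?_, ?_⟩
  · filter_upwards [hΘt.eventually hΨlin, hΘt.eventually hleft.eventually_nhds,
      hright.eventually_nhds, hΘC.eventually (by simp)] with y ⟨A, hA, hAc⟩ hl hr hy
    have hΘ := (hy.differentiableAt one_ne_zero).hasFDerivAt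
    refine differentiableAt_complex_of_real hΘ (map_complex_smul_of_inverse hAc ?_ ?_)
    · have h1 : HasFDerivAt (Θ ∘ Ψ) ((fderiv ℝ Θ y).comp A) (Θ y) :=
        HasFDerivAt.comp _ (by rw [hr.self_of_nhds]; exact hΘ) hA
      have h2 : HasFDerivAt (Θ ∘ Ψ) (ContinuousLinearMap.id ℝ E) (Θ y) :=
        (hasFDerivAt_id _).congr_of_eventuallyEq hl
      exact fun z => DFunLike.congr_fun (h1.unique h2) z
    · have h1 : HasFDerivAt (Ψ ∘ Θ) (A.comp (fderiv ℝ Θ y)) y := HasFDerivAt.comp _ hA hΘ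
      have h2 : HasFDerivAt (Ψ ∘ Θ) (ContinuousLinearMap.id ℝ E) y :=
        (hasFDerivAt_id _).congr_of_eventuallyEq hr
      exact fun z => DFunLike.congr_fun (h1.unique h2) z
  · filter_upwards [hΘt.eventually (hst.eventually hleft), hΘt.eventually hinv, hright]
      with y hl hi hr
    have : Ψ (s (Θ y)) = S (Ψ (Θ y)) := by
      simp only [Ψ, hi, map_smul, map_add, hSS]
      rw [add_comm]
    rw [hr] at this
    rw [← this, hl]

/-- The fixed space of a conjugate-linear involution `S` is a set of uniqueness for germs of
holomorphic functions at `0`: each `y` is `u + i v` with `u`, `v` fixed by `S`, and the function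
`t ↦ f (u + t v)` of one complex variable vanishes for real `t`. -/
theorem eventually_eq_zero_of_eq_zero_on_fixed {E : Type*} [NormedAddCommGroup E] [NormedSpace ℂ E]
    {S : E →L[ℝ] E} (hSc : ∀ (c : ℂ) (z : E), S (c • z) = starRingEnd ℂ c • S z)
    (hSS : ∀ z, S (S z) = z) {f : E → ℂ} (hf : ∀ᶠ y in 𝓝 0, DifferentiableAt ℂ f y)
    (hfix : ∀ᶠ y in 𝓝 0, S y = y → f y = 0) : ∀ᶠ y in 𝓝 0, f y = 0 := by
  obtain ⟨r, hr, hball⟩ := Metric.eventually_nhds_iff_ball.1 (hf.and hfix)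
  let u : E → E := fun y => (2⁻¹ : ℂ) • (y + S y)
  let v : E → E := fun y => (-(Complex.I * 2⁻¹)) • (y - S y)
  have hu : Continuous u := by fun_prop
  have hv : Continuous v := by fun_prop
  have hu0 : ∀ᶠ y in 𝓝 0, ‖u y‖ < r / 3 := by
    have : Tendsto (fun y => ‖u y‖) (𝓝 0) (𝓝 ‖u 0‖) := hu.norm.tendsto 0
    exact this.eventually_lt_const (by simp [u]; positivity)
  have hv0 : ∀ᶠ y in 𝓝 0, ‖v y‖ < r / 3 := by
    have : Tendsto (fun y => ‖v y‖) (𝓝 0) (𝓝 ‖v 0‖) := hv.norm.tendsto 0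
    exact this.eventually_lt_const (by simp [v]; positivity)
  filter_upwards [hu0, hv0] with y hyu hyv
  have hSu : S (u y) = u y := by
    simp only [u, hSc, map_add, hSS, map_inv₀, Complex.conj_ofNat]
    rw [add_comm]
  have hSv : S (v y) = v y := by
    simp only [v, hSc, map_sub, hSS, map_inv₀, Complex.conj_ofNat, map_neg, map_mul, Complex.conj_I]
    rw [← neg_sub y, smul_neg, ← neg_smul]
    simp
  have huv : u y + Complex.I • v y = y := by
    simp only [u, v, smul_smul]
    have : Complex.I * -(Complex.I * 2⁻¹) = 2⁻¹ := by
      rw [mul_neg, ← mul_assoc, Complex.I_mul_I]; ring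
    rw [this, ← smul_add, add_add_sub_cancel, ← two_smul ℂ y, smul_smul]
    norm_num
  let p : ℂ → E := fun t => u y + t • v y
  have hp : ∀ t ∈ Metric.ball (0 : ℂ) 2, p t ∈ Metric.ball (0 : E) r := by
    intro t ht
    rw [mem_ball_zero_iff] at ht ⊢
    calc ‖p t‖ ≤ ‖u y‖ + ‖t • v y‖ := norm_add_le _ _
      _ = ‖u y‖ + ‖t‖ * ‖v y‖ := by rw [norm_smul t]
      _ ≤ ‖u y‖ + 2 * ‖v y‖ := by gcongr
      _ < r := by linarith
  have hpd : Differentiable ℂ p := by fun_prop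
  have han : AnalyticOnNhd ℂ (f ∘ p) (Metric.ball (0 : ℂ) 2) := by
    refine DifferentiableOn.analyticOnNhd (fun t ht => ?_) Metric.isOpen_ball
    exact ((hball _ (hp t ht)).1.comp t (hpd t)).differentiableWithinAt
  have hreal : ∀ t : ℝ, (t : ℂ) ∈ Metric.ball (0 : ℂ) 2 → (f ∘ p) t = 0 := by
    intro t ht
    refine (hball _ (hp t ht)).2 ?_
    simp only [p, map_add, hSc, hSu, hSv, Complex.conj_ofReal]
  have hfreq : ∃ᶠ z : ℂ in 𝓝[≠] 0, (f ∘ p) z = 0 := by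
    have htend : Tendsto (fun t : ℝ => (t : ℂ)) (𝓝[≠] 0) (𝓝[≠] 0) := by
      refine tendsto_nhdsWithin_iff.2 ⟨?_, ?_⟩
      · exact (Complex.continuous_ofReal.tendsto' 0 0 rfl).mono_left nhdsWithin_le_nhds
      · filter_upwards [self_mem_nhdsWithin] with t ht
        simpa using ht
    refine htend.frequently (Eventually.frequently ?_)
    have : ∀ᶠ t : ℝ in 𝓝 0, (t : ℂ) ∈ Metric.ball (0 : ℂ) 2 :=
      (Complex.continuous_ofReal.tendsto' 0 0 rfl).eventually
        (Metric.ball_mem_nhds _ (by norm_num))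
    filter_upwards [nhdsWithin_le_nhds this] with t ht using hreal t ht
  have key := han.eqOn_zero_of_preconnected_of_frequently_eq_zero
    (convex_ball (0 : ℂ) 2).isPreconnected (Metric.mem_ball_self (by norm_num)) hfreq
  have hI : Complex.I ∈ Metric.ball (0 : ℂ) 2 := by simp
  have := key hI
  simpa [p, huv] using this

/-! ### Antiholomorphic involutions of complex Lie groups -/

theorem HasMFDerivAt.restrictScalars_real {E F : Type*} [NormedAddCommGroup E] [NormedSpace ℂ E]
    [NormedAddCommGroup F] [NormedSpace ℂ F] {M N : Type*} [TopologicalSpace M] [ChartedSpace E M]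
    [TopologicalSpace N] [ChartedSpace F N] {f : M → N} {x : M} {f' : E →L[ℂ] F}
    (h : HasMFDerivAt 𝓘(ℂ, E) 𝓘(ℂ, F) f x f') :
    HasMFDerivAt 𝓘(ℝ, E) 𝓘(ℝ, F) f x (f'.restrictScalars ℝ : E →L[ℝ] F) :=
  ⟨h.1, HasFDerivWithinAt.restrictScalars ℝ h.2⟩

section
variable {E : Type*} [NormedAddCommGroup E] [NormedSpace ℂ E]
  {GC : Type*} [TopologicalSpace GC] [ChartedSpace E GC] [Group GC]

theorem IsAntiholomorphicInvolution.hasMFDerivAt {σ : GC →* GC}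
    (hσ : IsAntiholomorphicInvolution E σ) (g : GC) :
    HasMFDerivAt 𝓘(ℝ, E) 𝓘(ℝ, E) σ g (realDifferential E σ g) :=
  ((hσ.smooth g).mdifferentiableAt (by simp)).hasMFDerivAt

/-- Near `1` a complex Lie group has a holomorphic parametrization `γ` in which a given
antiholomorphic involution becomes a conjugate-linear involution `S` of the model space. -/
theorem IsAntiholomorphicInvolution.exists_linearizing_chart [LieGroup 𝓘(ℂ, E) ω GC]
    [CompleteSpace E] {σ : GC →* GC} (hσ : IsAntiholomorphicInvolution E σ) :
    ∃ (S : E →L[ℝ] E) (γ : E → GC), (∀ (c : ℂ) (z : E), S (c • z) = starRingEnd ℂ c • S z) ∧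
      (∀ z, S (S z) = z) ∧ map γ (𝓝 0) = 𝓝 1 ∧
      (∀ᶠ y in 𝓝 0, MDifferentiableAt 𝓘(ℂ, E) 𝓘(ℂ, E) γ y) ∧
      ∀ᶠ y in 𝓝 0, σ (γ y) = γ (S y) := by
  have : IsManifold 𝓘(ℂ, E) 1 GC := IsManifold.of_le (n := ω) le_top
  let φ := extChartAt 𝓘(ℂ, E) (1 : GC)
  let s : E → E := φ ∘ σ ∘ φ.symm
  let x₀ : E := φ 1
  have hφ₀ : φ.symm x₀ = 1 := extChartAt_to_inv (I := 𝓘(ℂ, E)) (1 : GC)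
  have hs₀ : s x₀ = x₀ := by simp only [s, Function.comp_apply, hφ₀, map_one]; rfl
  have htgt : ∀ᶠ x in 𝓝 x₀, x ∈ φ.target := extChartAt_target_mem_nhds (I := 𝓘(ℂ, E)) (1 : GC)
  have hφsymm : map φ.symm (𝓝 x₀) = 𝓝 1 := by
    have := map_extChartAt_symm_nhdsWithin_range (I := 𝓘(ℂ, E)) (1 : GC)
    rwa [modelWithCornersSelf_coe, Set.range_id, nhdsWithin_univ] at this
  have hsymm_t : Tendsto φ.symm (𝓝 x₀) (𝓝 1) := hφsymm.le
  have hσt : Tendsto σ (𝓝 1) (𝓝 1) := hσ.smooth.continuous.tendsto' 1 1 (map_one σ)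
  have hsrc : ∀ᶠ g in 𝓝 (1 : GC), g ∈ φ.source :=
    extChartAt_source_mem_nhds (I := 𝓘(ℂ, E)) (1 : GC)
  have hs : ContDiffAt ℝ 1 s x₀ := by
    have h := (contMDiffAt_iff.1 (hσ.smooth 1)).2
    rw [map_one] at h
    simp only [modelWithCornersSelf_coe, Set.range_id, contDiffWithinAt_univ] at h
    exact h.of_le (by simp)
  have hφs : ∀ᶠ x in 𝓝 x₀, φ.symm (s x) = σ (φ.symm x) := by
    filter_upwards [hsymm_t.eventually (hσt.eventually hsrc)] with x hx
    exact φ.left_inv hx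
  have hinv : ∀ᶠ x in 𝓝 x₀, s (s x) = x := by
    filter_upwards [hφs, htgt] with x hx hxt
    have : s (s x) = φ (σ (φ.symm (s x))) := rfl
    rw [this, hx, hσ.involutive, φ.right_inv hxt]
  have hconj : ∀ᶠ x in 𝓝 x₀, ∀ (c : ℂ) (z : E),
      fderiv ℝ s x (c • z) = starRingEnd ℂ c • fderiv ℝ s x z := by
    filter_upwards [htgt, hsymm_t.eventually (hσt.eventually hsrc)] with x hx hxσ c z
    have h1 : HasMFDerivAt 𝓘(ℂ, E) 𝓘(ℂ, E) φ.symm x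
        (mfderiv 𝓘(ℂ, E) 𝓘(ℂ, E) φ.symm x : E →L[ℂ] E) :=
      ((mdifferentiableOn_extChartAt_symm x hx).mdifferentiableAt
        ((isOpen_extChartAt_target _).mem_nhds hx)).hasMFDerivAt
    have h3 : HasMFDerivAt 𝓘(ℂ, E) 𝓘(ℂ, E) φ (σ (φ.symm x))
        (mfderiv 𝓘(ℂ, E) 𝓘(ℂ, E) φ (σ (φ.symm x)) : E →L[ℂ] E) :=
      (mdifferentiableAt_extChartAt (by simpa [φ] using hxσ)).hasMFDerivAt
    have h := HasMFDerivAt.comp x h3.restrictScalars_real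
      (HasMFDerivAt.comp x (hσ.hasMFDerivAt (φ.symm x)) h1.restrictScalars_real)
    have h' : fderiv ℝ s x = _ := HasFDerivAt.fderiv (hasMFDerivAt_iff_hasFDerivAt.1 h)
    rw [h']
    set A : E →L[ℂ] E := mfderiv 𝓘(ℂ, E) 𝓘(ℂ, E) φ.symm x
    set B : E →L[ℂ] E := mfderiv 𝓘(ℂ, E) 𝓘(ℂ, E) φ (σ (φ.symm x))
    change B (realDifferential E σ _ (A (c • z))) =
      starRingEnd ℂ c • B (realDifferential E σ _ (A z))
    rw [map_smul, hσ.conj_linear, map_smul]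
  obtain ⟨S, Θ, hSc, hSS, hmap, hd, hΘS⟩ := exists_linearizing_inverse hs₀ hs hinv hconj
  have hΘt : Tendsto Θ (𝓝 0) (𝓝 x₀) := hmap.le
  refine ⟨S, φ.symm ∘ Θ, hSc, hSS, ?_, ?_, ?_⟩
  · rw [← map_map, hmap, hφsymm]
  · filter_upwards [hd, hΘt.eventually htgt] with y hy hyt
    refine MDifferentiableAt.comp y ?_ hy.mdifferentiableAt
    exact (mdifferentiableOn_extChartAt_symm _ hyt).mdifferentiableAt
        ((isOpen_extChartAt_target _).mem_nhds hyt)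
  · filter_upwards [hΘS, hΘt.eventually hφs] with y h1 h2
    rw [Function.comp_apply, Function.comp_apply, ← h1, h2]

end

/-! ### Invariant sesquilinear forms -/

section
variable {V : Type*} [NormedAddCommGroup V] [NormedSpace ℂ V]

/-- A sesquilinear form on a finite-dimensional complex space, as a continuous real-bilinear map.
Differentiation over `ℝ` is needed because the form is conjugate-linear in one variable. -/
def realBilinear [FiniteDimensional ℂ V] (B : V →ₗ⋆[ℂ] V →ₗ[ℂ] ℂ) : V →L[ℝ] V →L[ℝ] ℂ :=
  haveI : FiniteDimensional ℝ V := FiniteDimensional.complexToReal V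
  LinearMap.toContinuousLinearMap
    { toFun := fun v => LinearMap.toContinuousLinearMap ((B v).restrictScalars ℝ)
      map_add' := fun v v' => by ext w; simp
      map_smul' := fun c v => by
        ext w
        have : B (c • v) = (c : ℂ) • B v := by
          rw [← Complex.coe_smul, map_smulₛₗ, Complex.conj_ofReal]
        simp only [LinearMap.coe_toContinuousLinearMap', LinearMap.restrictScalars_apply, this,
          RingHom.id_apply, smul_apply, LinearMap.smul_apply, Complex.coe_smul] }

@[simp] theorem realBilinear_apply [FiniteDimensional ℂ V] (B : V →ₗ⋆[ℂ] V →ₗ[ℂ] ℂ) (v w : V) :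
    realBilinear B v w = B v w := rfl

end

section
variable {E : Type*} [NormedAddCommGroup E] [NormedSpace ℂ E]
  {GC : Type*} [TopologicalSpace GC] [ChartedSpace E GC] [Group GC]
  {V : Type*} [NormedAddCommGroup V] [NormedSpace ℂ V]

/-- The subgroup of all `g` with `⟨π(g)v, π(σ g)w⟩ = ⟨v, w⟩` for all `v` and `w`. -/
def twistedInvarianceSubgroup (π : Representation ℂ GC V) (σ : GC →* GC)
    (B : V →ₗ⋆[ℂ] V →ₗ[ℂ] ℂ) : Subgroup GC where
  carrier := {g | ∀ v w, B (π g v) (π (σ g) w) = B v w}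
  one_mem' := fun v w => by simp
  mul_mem' := fun {a b} ha hb v w => by
    simp only [map_mul, Module.End.mul_apply]
    rw [ha, hb]
  inv_mem' := fun {a} ha v w => by
    rw [← ha]
    simp [← Module.End.mul_apply, ← map_mul]

theorem Subgroup.eq_top_of_mem_nhds_one {G : Type*} [Group G] [TopologicalSpace G]
    [IsTopologicalGroup G] [ConnectedSpace G] (H : Subgroup G) (hH : (H : Set G) ∈ 𝓝 1) :
    H = ⊤ := by
  have ho : IsOpen (H : Set G) := H.isOpen_of_mem_nhds hH
  have hc : IsClopen (H : Set G) := ⟨H.isClosed_of_isOpen ho, ho⟩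
  exact SetLike.coe_injective (hc.eq_univ ⟨1, H.one_mem⟩)

theorem IsHolomorphicRep.mdifferentiableAt {π : Representation ℂ GC V} (hπ : IsHolomorphicRep E π)
    (v : V) (g : GC) : MDifferentiableAt 𝓘(ℂ, E) 𝓘(ℂ, V) (fun g => π g v) g :=
  (hπ v g).mdifferentiableAt (by simp)

theorem IsAntiholomorphicInvolution.tendsto_one {σ : GC →* GC}
    (hσ : IsAntiholomorphicInvolution E σ) : Tendsto σ (𝓝 1) (𝓝 1) :=
  hσ.smooth.continuous.tendsto' 1 1 (map_one σ)

variable [FiniteDimensional ℂ V]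

/-- The relation `⟨π(g)v, π(σ g)w⟩ = ⟨v, w⟩` defines a subgroup, so on a connected group it holds
everywhere once it holds near `1`. The neighbourhood may depend on `v` and `w`, as finitely many
pairs of basis vectors suffice. -/
theorem twistedInvariant_of_eventually [IsTopologicalGroup GC] [ConnectedSpace GC] {σ : GC →* GC}
    {π : Representation ℂ GC V} {B : V →ₗ⋆[ℂ] V →ₗ[ℂ] ℂ}
    (h : ∀ v w : V, ∀ᶠ g in 𝓝 (1 : GC), B (π g v) (π (σ g) w) = B v w) (g : GC) (v w : V) :
    B (π g v) (π (σ g) w) = B v w := by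
  let b := Module.finBasis ℂ V
  have hb : ∀ᶠ g in 𝓝 (1 : GC), ∀ i j, B (π g (b i)) (π (σ g) (b j)) = B (b i) (b j) :=
    eventually_all.2 fun i => eventually_all.2 fun j => h _ _
  have htop : twistedInvarianceSubgroup π σ B = ⊤ := by
    refine Subgroup.eq_top_of_mem_nhds_one _ ?_
    filter_upwards [hb] with x hx v w
    have : (B.compl₂ (π (σ x))).comp (π x) = B := LinearMap.ext_basis b b hx
    exact LinearMap.congr_fun₂ this v w
  have hg : g ∈ twistedInvarianceSubgroup π σ B := htop ▸ Subgroup.mem_top g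
  exact hg v w

/-- Analytic continuation from the real form: a form invariant under the fixed points of `σ`
satisfies `⟨π(g)v, π(σ g)w⟩ = ⟨v, w⟩` on the whole complex group. -/
theorem twistedInvariant_of_isGroupInvariant [LieGroup 𝓘(ℂ, E) ω GC] [CompleteSpace E]
    [ConnectedSpace GC] {σ : GC →* GC} (hσ : IsAntiholomorphicInvolution E σ)
    {π : Representation ℂ GC V} (hπ : IsHolomorphicRep E π) {B : V →ₗ⋆[ℂ] V →ₗ[ℂ] ℂ}
    (hB : IsGroupInvariant π (fixedPointSubgroup σ) B) (g : GC) (v w : V) :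
    B (π g v) (π (σ g) w) = B v w := by
  have : IsTopologicalGroup GC := topologicalGroup_of_lieGroup 𝓘(ℂ, E) ω
  obtain ⟨S, γ, hSc, hSS, hγ, hγd, hγS⟩ := hσ.exists_linearizing_chart
  have hS0 : Tendsto S (𝓝 0) (𝓝 0) := S.continuous.tendsto' 0 0 (map_zero S)
  have horb : ∀ u : V, ∀ᶠ y in 𝓝 0, DifferentiableAt ℂ (fun y => π (γ y) u) y := fun u => by
    filter_upwards [hγd] with y hy
    exact ((hπ.mdifferentiableAt u (γ y)).comp y hy).differentiableAt
  -- in a linearizing chart `B (π (σ g) v) (π g w)` is holomorphic: two conjugations cancel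
  have hzero : ∀ u w : V, ∀ᶠ y in 𝓝 0, B (π (γ (S y)) u) (π (γ y) w) - B u w = 0 := fun u w => by
    refine eventually_eq_zero_of_eq_zero_on_fixed hSc hSS ?_ ?_
    · filter_upwards [hS0.eventually (horb u), horb w] with y h1 h2
      have h1' := (h1.hasFDerivAt.restrictScalars ℝ).comp y S.hasFDerivAt
      have h := ((realBilinear B).hasFDerivAt_of_bilinear h1'
        (h2.hasFDerivAt.restrictScalars ℝ)).sub_const (B u w)
      refine differentiableAt_complex_of_real h fun c z => ?_
      simp [hSc, mul_add]
    · filter_upwards [hγS] with y hy hfix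
      rw [hfix] at hy ⊢
      rw [hB (γ y) hy, sub_self]
  have hnear : ∀ u w : V, ∀ᶠ g in 𝓝 (1 : GC), B (π g u) (π (σ g) w) = B u w := fun u w => by
    have h : ∀ᶠ g in 𝓝 (1 : GC), B (π (σ g) u) (π g w) = B u w := by
      rw [← hγ, eventually_map]
      filter_upwards [hzero u w, hγS] with y hy hs
      rw [hs]
      exact sub_eq_zero.1 hy
    filter_upwards [hσ.tendsto_one.eventually h] with g hg
    rwa [hσ.involutive] at hg
  exact twistedInvariant_of_eventually hnear g v w

/-- The real differential at `1` of `g ↦ ⟨π(g)v, π(σ g)w⟩` is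
`X ↦ ⟨X.v, w⟩ + ⟨v, σ(X).w⟩`. -/
theorem hasMFDerivAt_twistedCoefficient
    {σ : GC →* GC} (hσ : IsAntiholomorphicInvolution E σ)
    {π : Representation ℂ GC V} (hπ : IsHolomorphicRep E π) (B : V →ₗ⋆[ℂ] V →ₗ[ℂ] ℂ) (v w : V) :
    ∃ D : E →L[ℝ] ℂ,
      HasMFDerivAt 𝓘(ℝ, E) 𝓘(ℝ, ℂ) (fun g => B (π g v) (π (σ g) w)) (1 : GC) D ∧
      ∀ X : GroupLieAlgebra 𝓘(ℂ, E) GC,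
        D X = B (lieAction π X v) w + B v (lieAction π (lieInvolution σ X) w) := by
  let A : V → E →L[ℂ] V := fun u => mfderiv 𝓘(ℂ, E) 𝓘(ℂ, V) (fun g : GC => π g u) 1
  have hA : ∀ (u : V) (x : GC), x = 1 → HasMFDerivAt 𝓘(ℝ, E) 𝓘(ℝ, V) (fun g : GC => π g u) x
      ((A u).restrictScalars ℝ : E →L[ℝ] V) := by
    rintro u x rfl
    exact (hπ.mdifferentiableAt u 1).hasMFDerivAt.restrictScalars_real
  have hA' := HasMFDerivAt.comp (1 : GC) (hA w (σ 1) (map_one σ)) (hσ.hasMFDerivAt 1)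
  have h := (realBilinear B).hasFDerivWithinAt_of_bilinear (hA v 1 rfl).2 hA'.2
  have hcont : ContinuousAt (fun g => B (π g v) (π (σ g) w)) (1 : GC) :=
    ((realBilinear B).continuous.continuousAt.comp (hA v 1 rfl).1).clm_apply hA'.1
  refine ⟨_, ⟨hcont, h⟩, fun X => ?_⟩
  have e₁ : writtenInExtChartAt 𝓘(ℝ, E) 𝓘(ℝ, V) (1 : GC) (fun g => π g v)
      (extChartAt 𝓘(ℝ, E) (1 : GC) 1) = v := by
    simp [writtenInExtChartAt]
    rfl
  have e₂ : writtenInExtChartAt 𝓘(ℝ, E) 𝓘(ℝ, V) (1 : GC) ((fun g => π g w) ∘ σ)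
      (extChartAt 𝓘(ℝ, E) (1 : GC) 1) = w := by
    simp [writtenInExtChartAt]
    rfl
  rw [e₁, e₂, add_comm]
  rfl

theorem isLieInvariant_of_twistedInvariant {σ : GC →* GC} (hσ : IsAntiholomorphicInvolution E σ)
    {π : Representation ℂ GC V} (hπ : IsHolomorphicRep E π) {B : V →ₗ⋆[ℂ] V →ₗ[ℂ] ℂ}
    (hB : ∀ g v w, B (π g v) (π (σ g) w) = B v w) : IsLieInvariant E π σ B := by
  intro X v w
  obtain ⟨D, hD, hDX⟩ := hasMFDerivAt_twistedCoefficient hσ hπ B v w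
  have h0 : HasMFDerivAt 𝓘(ℝ, E) 𝓘(ℝ, ℂ) (fun g => B (π g v) (π (σ g) w)) (1 : GC)
      (0 : E →L[ℝ] ℂ) :=
    (hasMFDerivAt_const (B v w) (1 : GC)).congr_of_eventuallyEq
      (Eventually.of_forall fun g => hB g v w)
  have : D X = 0 := by
    have := hasMFDerivAt_unique hD h0
    rw [this]; rfl
  rw [hDX] at this
  rw [map_neg]
  exact eq_neg_of_add_eq_zero_left this

/-- Invariance under the Lie algebra integrates to the connected complex group: the functions
`g ↦ ⟨π(g)v, π(σ g)w⟩` have zero differential at `1` for all `v` and `w`, hence at every point. -/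
theorem twistedInvariant_of_isLieInvariant [LieGroup 𝓘(ℂ, E) ω GC]
    [ConnectedSpace GC] {σ : GC →* GC} (hσ : IsAntiholomorphicInvolution E σ)
    {π : Representation ℂ GC V} (hπ : IsHolomorphicRep E π) {B : V →ₗ⋆[ℂ] V →ₗ[ℂ] ℂ}
    (hB : IsLieInvariant E π σ B) (g : GC) (v w : V) :
    B (π g v) (π (σ g) w) = B v w := by
  have : IsTopologicalGroup GC := topologicalGroup_of_lieGroup 𝓘(ℂ, E) ω
  have : IsManifold 𝓘(ℂ, E) 1 GC := IsManifold.of_le (n := ω) le_top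
  refine twistedInvariant_of_eventually (fun v w => ?_) g v w
  have h1 : ∀ (v w : V) (x : GC), x = 1 → HasMFDerivAt 𝓘(ℝ, E) 𝓘(ℝ, ℂ)
      (fun g => B (π g v) (π (σ g) w)) x (0 : E →L[ℝ] ℂ) := by
    rintro v w x rfl
    obtain ⟨D, hD, hDX⟩ := hasMFDerivAt_twistedCoefficient hσ hπ B v w
    have : D = 0 := by
      ext X
      rw [hDX X, hB X v w, map_neg, neg_add_cancel]
      rfl
    rwa [this] at hD
  -- right translations move the vanishing of the derivative from `1` to every point
  have h2 : ∀ x : GC, HasMFDerivAt 𝓘(ℝ, E) 𝓘(ℝ, ℂ)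
      (fun g => B (π g v) (π (σ g) w)) x (0 : E →L[ℝ] ℂ) := by
    intro x
    have hR : HasMFDerivAt 𝓘(ℂ, E) 𝓘(ℂ, E) (fun g : GC => g * x⁻¹) x
        (mfderiv 𝓘(ℂ, E) 𝓘(ℂ, E) (fun g : GC => g * x⁻¹) x : E →L[ℂ] E) :=
      ((contMDiff_mul_right (I := 𝓘(ℂ, E)) (n := ω) (a := x⁻¹) x).mdifferentiableAt
        (by simp)).hasMFDerivAt
    have h := HasMFDerivAt.comp x (h1 (π x v) (π (σ x) w) (x * x⁻¹) (mul_inv_cancel x))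
      hR.restrictScalars_real
    have e : (fun g => B (π g v) (π (σ g) w)) =
        (fun g => B (π g (π x v)) (π (σ g) (π (σ x) w))) ∘ fun g : GC => g * x⁻¹ := by
      ext g
      simp [← Module.End.mul_apply, ← map_mul]
    rw [e]
    exact h
  let φ := extChartAt 𝓘(ℂ, E) (1 : GC)
  let f : E → ℂ := fun y => B (π (φ.symm y) v) (π (σ (φ.symm y)) w)
  obtain ⟨r, hr, hball⟩ := Metric.mem_nhds_iff.1
    (extChartAt_target_mem_nhds (I := 𝓘(ℂ, E)) (1 : GC))
  have hf : ∀ y ∈ Metric.ball (φ 1) r, HasFDerivAt f (0 : E →L[ℝ] ℂ) y := by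
    intro y hy
    have h3 : HasMFDerivAt 𝓘(ℂ, E) 𝓘(ℂ, E) φ.symm y
        (mfderiv 𝓘(ℂ, E) 𝓘(ℂ, E) φ.symm y : E →L[ℂ] E) :=
      ((mdifferentiableOn_extChartAt_symm y (hball hy)).mdifferentiableAt
        ((isOpen_extChartAt_target _).mem_nhds (hball hy))).hasMFDerivAt
    exact hasMFDerivAt_iff_hasFDerivAt.1
      (HasMFDerivAt.comp y (h2 (φ.symm y)) h3.restrictScalars_real)
  have hconst : ∀ y ∈ Metric.ball (φ 1) r, f y = B v w := by
    intro y hy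
    have h := Metric.isOpen_ball.is_const_of_fderiv_eq_zero (𝕜 := ℝ)
      (convex_ball (φ 1) r).isPreconnected
      (fun z hz => (hf z hz).differentiableAt.differentiableWithinAt)
      (fun z hz => (hf z hz).fderiv) hy (Metric.mem_ball_self hr)
    rw [h]
    have : φ.symm (φ 1) = 1 := extChartAt_to_inv (I := 𝓘(ℂ, E)) (1 : GC)
    simp [f, this]
  filter_upwards [extChartAt_source_mem_nhds (I := 𝓘(ℂ, E)) (1 : GC),
    (continuousAt_extChartAt (I := 𝓘(ℂ, E)) (1 : GC)).eventually
      (Metric.ball_mem_nhds _ hr)] with x hxs hxb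
  have := hconst _ hxb
  have e : φ.symm (φ x) = x := φ.left_inv hxs
  change B (π (φ.symm (φ x)) v) (π (σ (φ.symm (φ x))) w) = B v w at this
  rwa [e] at this

end

/-! ### Averaging, adjoint operators and hermitian combinations -/

section
variable {V : Type*} [NormedAddCommGroup V] [NormedSpace ℂ V]

/-- A representation of a compact group on a finite-dimensional complex space preserves a
nondegenerate sesquilinear form, obtained by averaging an inner product. -/
theorem exists_invariant_form [FiniteDimensional ℂ V] {K : Type*} [TopologicalSpace K] [Group K]
    [IsTopologicalGroup K] [CompactSpace K] (ρ : Representation ℂ K V)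
    (hρ : ∀ v, Continuous fun k => ρ k v) :
    ∃ h : V →ₗ⋆[ℂ] V →ₗ[ℂ] ℂ, (∀ k v w, h (ρ k v) (ρ k w) = h v w) ∧ h.SeparatingRight := by
  borelize K
  let μ : MeasureTheory.Measure K := MeasureTheory.Measure.haar
  let e : V ≃ₗ[ℂ] EuclideanSpace ℂ (Fin (Module.finrank ℂ V)) :=
    (Module.finBasis ℂ V).equivFun.trans (WithLp.linearEquiv 2 ℂ _).symm
  have he : Continuous e := e.toLinearMap.continuous_of_finiteDimensional
  -- with `k⁻¹` in place of `k`, left invariance of the Haar measure yields invariance of the form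
  let f : V → V → K → ℂ := fun v w k => inner ℂ (e (ρ k⁻¹ v)) (e (ρ k⁻¹ w))
  have hc : ∀ v, Continuous fun k => e (ρ k⁻¹ v) := fun v =>
    he.comp ((hρ v).comp continuous_inv)
  have hf : ∀ v w, MeasureTheory.Integrable (f v w) μ := fun v w =>
    ((hc v).inner (hc w)).integrable_of_hasCompactSupport (HasCompactSupport.of_compactSpace _)
  let h : V →ₗ⋆[ℂ] V →ₗ[ℂ] ℂ := LinearMap.mk₂'ₛₗ (starRingEnd ℂ) (RingHom.id ℂ)
    (fun v w => ∫ k, f v w k ∂μ)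
    (fun v v' w => by
      rw [← MeasureTheory.integral_add (hf _ _) (hf _ _)]
      simp only [f, map_add, inner_add_left])
    (fun c v w => by
      rw [smul_eq_mul, ← MeasureTheory.integral_const_mul]
      simp only [f, map_smul, inner_smul_left])
    (fun v w w' => by
      rw [← MeasureTheory.integral_add (hf _ _) (hf _ _)]
      simp only [f, map_add, inner_add_right])
    (fun c v w => by
      rw [RingHom.id_apply, smul_eq_mul, ← MeasureTheory.integral_const_mul]
      simp only [f, map_smul, inner_smul_right])
  refine ⟨h, fun k v w => ?_, fun v hv => ?_⟩
  · change ∫ x, f (ρ k v) (ρ k w) x ∂μ = ∫ x, f v w x ∂μ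
    rw [← MeasureTheory.integral_mul_left_eq_self (f v w) k⁻¹]
    congr 1
    ext x
    simp [f, ← Module.End.mul_apply, ← map_mul]
  · by_contra hne
    have h1 : h v v = ((∫ k, ‖e (ρ k⁻¹ v)‖ ^ 2 ∂μ : ℝ) : ℂ) := by
      change ∫ x, f v v x ∂μ = _
      rw [← integral_complex_ofReal]
      congr 1
      ext x
      simp [f, inner_self_eq_norm_sq_to_K]
    have h2 : 0 < ∫ k, ‖e (ρ k⁻¹ v)‖ ^ 2 ∂μ :=
      ((hc v).norm.pow 2).integral_pos_of_hasCompactSupport_nonneg_nonzero (x := 1)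
        (HasCompactSupport.of_compactSpace _) (fun x => by positivity) (by simpa using hne)
    rw [hv v] at h1
    exact h2.ne (by exact_mod_cast h1)

/-- Every sesquilinear form is `⟨v, T w⟩` for an operator `T`, if `⟨·, ·⟩` separates points on the
right. -/
theorem exists_operator_of_separatingRight [FiniteDimensional ℂ V] {h : V →ₗ⋆[ℂ] V →ₗ[ℂ] ℂ}
    (hh : h.SeparatingRight) (B : V →ₗ⋆[ℂ] V →ₗ[ℂ] ℂ) :
    ∃ T : V →ₗ[ℂ] V, ∀ v w, h v (T w) = B v w := by
  let b := Module.finBasis ℂ V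
  let L : V →ₗ[ℂ] (Fin (Module.finrank ℂ V) → ℂ) := LinearMap.pi fun i => h (b i)
  have hL : Function.Injective L := by
    refine (injective_iff_map_eq_zero L).2 fun w hw => hh w fun v => ?_
    have : h.flip w = 0 := b.ext fun i => congrFun hw i
    exact LinearMap.congr_fun this v
  let e := L.linearEquivOfInjective hL (by simp)
  refine ⟨e.symm.toLinearMap ∘ₗ LinearMap.pi fun i => B (b i), fun v w => ?_⟩
  have : h.flip (e.symm (fun i => B (b i) w)) = B.flip w := by
    refine b.ext fun i => ?_
    exact congrFun (e.apply_symm_apply (fun i => B (b i) w)) i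
  exact LinearMap.congr_fun this v

/-- The conjugate transpose `(v, w) ↦ conj ⟨w, v⟩` of a sesquilinear form. -/
def conjTransposeForm (B : V →ₗ⋆[ℂ] V →ₗ[ℂ] ℂ) : V →ₗ⋆[ℂ] V →ₗ[ℂ] ℂ :=
  LinearMap.mk₂'ₛₗ (starRingEnd ℂ) (RingHom.id ℂ) (fun v w => starRingEnd ℂ (B w v))
    (fun v v' w => by simp) (fun c v w => by simp) (fun w v v' => by simp)
    (fun c v w => by simp)

@[simp] theorem conjTransposeForm_apply (B : V →ₗ⋆[ℂ] V →ₗ[ℂ] ℂ) (v w : V) :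
    conjTransposeForm B v w = starRingEnd ℂ (B w v) := rfl

/-- For some `c` the hermitian form `c B + conj c Bᴴ` is nondegenerate: writing `Bᴴ(v, w)` as
`B(v, A w)`, this holds as soon as `-c / conj c` is not an eigenvalue of `A`. -/
theorem exists_isNondegHermitian_combination [FiniteDimensional ℂ V] {B : V →ₗ⋆[ℂ] V →ₗ[ℂ] ℂ}
    (hB : B.SeparatingRight) :
    ∃ c : ℂ, IsNondegHermitian (c • B + starRingEnd ℂ c • conjTransposeForm B) := by
  obtain ⟨A, hA⟩ := exists_operator_of_separatingRight hB (conjTransposeForm B)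
  -- `c` is sought on the line `Re c = 1`, where `-c / conj c` takes each value at most once
  let z : ℝ → ℂ := fun t => 1 + t * Complex.I
  have hz : ∀ t, z t ≠ 0 := fun t ht => by
    have := congrArg Complex.re ht
    simp [z] at this
  have hzc : ∀ t, starRingEnd ℂ (z t) ≠ 0 := fun t => (map_ne_zero _).2 (hz t)
  let q : ℝ → ℂ := fun t => -(z t / starRingEnd ℂ (z t))
  have hq : Function.Injective q := by
    intro t t' htt
    simp only [q, neg_inj, div_eq_div_iff (hzc t) (hzc t')] at htt
    have := congrArg Complex.im htt
    simp [z] at this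
    linarith
  obtain ⟨t, ht⟩ := ((Module.End.finite_spectrum A).preimage hq.injOn).exists_notMem
  have hsymm : ∀ v w, starRingEnd ℂ ((z t • B + starRingEnd ℂ (z t) • conjTransposeForm B) v w) =
      (z t • B + starRingEnd ℂ (z t) • conjTransposeForm B) w v := fun v w => by
    simp [add_comm]
  have hright : (z t • B + starRingEnd ℂ (z t) • conjTransposeForm B).SeparatingRight := by
    intro w hw
    by_contra hne
    refine ht (Module.End.HasEigenvalue.mem_spectrum
      (Module.End.hasEigenvalue_of_hasEigenvector (x := w) ⟨?_, hne⟩))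
    rw [Module.End.mem_eigenspace_iff]
    have h0 : z t • w + starRingEnd ℂ (z t) • A w = 0 := hB _ fun v => by
      rw [map_add, map_smul, map_smul, hA]
      exact hw v
    rw [← smul_right_inj (hzc t), eq_neg_of_add_eq_zero_right h0, smul_smul, mul_neg,
      mul_div_cancel₀ _ (hzc t), neg_smul]
  refine ⟨z t, ⟨hsymm⟩, fun v hv => hright v fun w => ?_, hright⟩
  rw [← hsymm, hv, map_zero]

section
variable {G : Type*} [Group G] {π : Representation ℂ G V} {σ τ : G →* G}
  {B h : V →ₗ⋆[ℂ] V →ₗ[ℂ] ℂ}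

theorem twistedInvariant_hermitian_combination (hσ : Function.Involutive σ)
    (hB : ∀ g v w, B (π g v) (π (σ g) w) = B v w) (c : ℂ) (g : G) (v w : V) :
    (c • B + starRingEnd ℂ c • conjTransposeForm B) (π g v) (π (σ g) w) =
      (c • B + starRingEnd ℂ c • conjTransposeForm B) v w := by
  have := hB (σ g) w v
  rw [hσ] at this
  simp [hB, this]

/-- If `h` satisfies the twisted invariance for `τ` and `B` the one for `σ`, then the operator `T`
with `B(v, w) = h(v, T w)` intertwines `π` with its twist by `τ ∘ σ`. -/
theorem exists_intertwiner_of_twistedInvariant [FiniteDimensional ℂ V] (hσ : Function.Involutive σ)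
    (hh : h.SeparatingRight) (hτ : ∀ g v w, h (π g v) (π (τ g) w) = h v w)
    (hB : B.SeparatingRight) (hσB : ∀ g v w, B (π g v) (π (σ g) w) = B v w) :
    ∃ T : V ≃ₗ[ℂ] V, ∀ g : G,
      T.toLinearMap ∘ₗ π g = twist π (τ.comp σ) g ∘ₗ T.toLinearMap := by
  obtain ⟨T, hT⟩ := exists_operator_of_separatingRight hh B
  have hinj : Function.Injective T :=
    (injective_iff_map_eq_zero T).2 fun w hw => hB w fun v => by rw [← hT, hw, map_zero]
  refine ⟨LinearEquiv.ofInjectiveEndo T hinj, fun g => LinearMap.ext fun w => ?_⟩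
  change T (π g w) = π (τ (σ g)) (T w)
  refine sub_eq_zero.1 (hh _ fun v => ?_)
  have hv : π (σ g) (π (σ g)⁻¹ v) = v := by simp [← Module.End.mul_apply, ← map_mul]
  have h1 := hσB (σ g) (π (σ g)⁻¹ v) w
  rw [hσ] at h1
  rw [← hv, map_sub, hT, h1, hτ, hT, sub_self]

/-- Conversely, an intertwiner of the restrictions to the fixed points of `σ` gives the invariant
form `h(v, T w)`. -/
theorem isGroupInvariant_of_intertwiner (hτ : ∀ g v w, h (π g v) (π (τ g) w) = h v w)
    (T : V →ₗ[ℂ] V)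
    (hT : ∀ g ∈ fixedPointSubgroup σ, ∀ w, T (π g w) = π (τ (σ g)) (T w)) :
    IsGroupInvariant π (fixedPointSubgroup σ) (h.compl₂ T) := by
  intro g hg v w
  have hg' : σ g = g := hg
  rw [LinearMap.compl₂_apply, LinearMap.compl₂_apply, hT g hg, hg', hτ]

end
end

/-! ### The equivalence -/

theorem proposition3p1
    {E : Type*} [NormedAddCommGroup E] [NormedSpace ℂ E] [FiniteDimensional ℂ E]
    {GC : Type*} [TopologicalSpace GC] [ChartedSpace E GC] [Group GC]
    [LieGroup 𝓘(ℂ, E) ω GC] [T2Space GC] [ConnectedSpace GC]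
    {V : Type*} [NormedAddCommGroup V] [NormedSpace ℂ V] [FiniteDimensional ℂ V]
    (σ τ : GC →* GC)
    (hσ : IsAntiholomorphicInvolution E σ) (hτ : IsAntiholomorphicInvolution E τ)
    (hU : IsCompact (fixedPointSubgroup τ : Set GC))
    (hcomm : ∀ g : GC, τ (σ g) = σ (τ g))
    (π : Representation ℂ GC V) (hπ : IsHolomorphicRep E π) :
    List.TFAE [
      ∃ B : V →ₗ⋆[ℂ] V →ₗ[ℂ] ℂ, IsNondegHermitian B ∧
        IsGroupInvariant π (fixedPointSubgroup σ) B,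
      ∃ B : V →ₗ⋆[ℂ] V →ₗ[ℂ] ℂ, IsNondegHermitian B ∧ IsLieInvariant E π σ B,
      ∃ B : V →ₗ⋆[ℂ] V →ₗ[ℂ] ℂ, IsNondegHermitian B ∧
        IsGroupInvariant π (fixedPointSubgroup σ) B ∧ IsLieInvariant E π σ B,
      Nonempty ((restrictRep π (fixedPointSubgroup σ)).Equiv
        (restrictRep (twist π (τ.comp σ)) (fixedPointSubgroup σ))),
      ∃ T : V ≃ₗ[ℂ] V, ∀ g : GC,
        T.toLinearMap ∘ₗ π g = twist π (τ.comp σ) g ∘ₗ T.toLinearMap] := by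
  have : CompleteSpace E := FiniteDimensional.complete ℂ E
  have : IsTopologicalGroup GC := topologicalGroup_of_lieGroup 𝓘(ℂ, E) ω
  have : CompactSpace (fixedPointSubgroup τ) := isCompact_iff_compactSpace.1 hU
  obtain ⟨h, hinv, hsep⟩ := exists_invariant_form (restrictRep π (fixedPointSubgroup τ))
    fun v => (hπ v).continuous.comp continuous_subtype_val
  have hhτ : ∀ g v w, h (π g v) (π (τ g) w) = h v w :=
    twistedInvariant_of_isGroupInvariant hτ hπ fun g hg v w => hinv ⟨g, hg⟩ v w
  tfae_have 1 → 5 := by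
    rintro ⟨B, ⟨-, -, hB⟩, hBG⟩
    exact exists_intertwiner_of_twistedInvariant hσ.involutive hsep hhτ hB
      (twistedInvariant_of_isGroupInvariant hσ hπ hBG)
  tfae_have 2 → 5 := by
    rintro ⟨B, ⟨-, -, hB⟩, hBL⟩
    exact exists_intertwiner_of_twistedInvariant hσ.involutive hsep hhτ hB
      (twistedInvariant_of_isLieInvariant hσ hπ hBL)
  tfae_have 5 → 4 := by
    rintro ⟨T, hT⟩
    exact ⟨{ T with isIntertwining' := fun g => hT g }⟩
  tfae_have 4 → 3 := by
    rintro ⟨T⟩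
    have hBG := isGroupInvariant_of_intertwiner (σ := σ) hhτ T.toLinearEquiv.toLinearMap
      fun g hg w => LinearMap.congr_fun (T.isIntertwining' ⟨g, hg⟩) w
    have hB : (h.compl₂ T.toLinearEquiv.toLinearMap).SeparatingRight := fun w hw =>
      T.toLinearEquiv.map_eq_zero_iff.1 (hsep _ hw)
    obtain ⟨c, hc⟩ := exists_isNondegHermitian_combination hB
    have hext := twistedInvariant_hermitian_combination hσ.involutive
      (twistedInvariant_of_isGroupInvariant hσ hπ hBG) c
    refine ⟨_, hc, fun g hg v w => ?_, isLieInvariant_of_twistedInvariant hσ hπ hext⟩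
    have hg' : σ g = g := hg
    have := hext g v w
    rwa [hg'] at this
  tfae_have 3 → 1 := fun ⟨B, hB, hBG, _⟩ => ⟨B, hB, hBG⟩
  tfae_have 3 → 2 := fun ⟨B, hB, _, hBL⟩ => ⟨B, hB, hBL⟩
  tfae_finish

end
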